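/- Let $n\ge 1$, and let $\mathscr{RH}_\infty^{n\times n}$ be the set of $n\times n$ matrices of proper real-rational functions of $s$ without poles in the closed right half-plane $\{\Re s\ge 0\}$. Let $\mathcal C$ (respectively $\mathcal C_s$) be the set of all $R\in\mathscr{RH}_\infty^{n\times n}$ such that the Hermitian matrix $j[R(j\omega)-R(j\omega)^*]$ is positive semidefinite (respectively positive definite) for every $\omega\in(0,\infty)$. Let $M\in\mathcal C$ and $N\in\mathcal C_s$ satisfy $M(\infty)N(\infty)=0$ and $N(\infty)\ge 0$ (positive semidefinite), where $R(\infty)=\lim_{s\to\infty}R(s)$. Then all eigenvalues of $M(0)N(0)$ are real, and, with $\overline\lambda$ denoting the largest eigenvalue, $$[M,N]\text{ is internally stable}\iff \overline\lambda\big(M(0)N(0)\big)<1 .$$ Here $[M,N]$ is the positive feedback interconnection $e_1=w_1+Ne_2$, $e_2=w_2+Me_1$ of $M$ and $N$; it is internally stable if $\begin{pmatrix} I&-N\\-M&I\end{pmatrix}$ is invertible as a matrix of rational functions and its inverse, the transfer matrix from $(w_1,w_2)$ to $(e_1,e_2)$, lies in $\mathscr{RH}_\infty^{2n\times 2n}$.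 -/

import Mathlib

open scoped ComplexOrder

namespace NegImag

/-- Transfer function matrices with real-rational entries in the variable `s`. -/
abbrev TransferMatrix (m n : Type*) := Matrix m n (RatFunc ℝ)

/-- A scalar real-rational function is proper and has no pole in the closed right half plane.
`num` and `denom` are the coprime numerator and the monic denominator. -/
def IsProperStable (r : RatFunc ℝ) : Prop :=
  r.num.natDegree ≤ r.denom.natDegree ∧
    ∀ s : ℂ, 0 ≤ s.re → Polynomial.aeval s r.denom ≠ 0

/-- The real-rational stable transfer matrices `RH_∞`: every entry is proper and stable. -/
def RHInf (m n : Type*) : Set (TransferMatrix m n) :=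
  {R | ∀ i j, IsProperStable (R i j)}

/-- The value `R(s)` at a complex number `s` that is not a pole of `R`. -/
noncomputable def evalAt {m n : Type*} (R : TransferMatrix m n) (s : ℂ) : Matrix m n ℂ :=
  R.map (RatFunc.eval (algebraMap ℝ ℂ) s)

/-- The value at infinity of a proper real-rational function `p / q`: the coefficient of `p` in
degree `deg q`, divided by the leading coefficient of `q`. -/
noncomputable def valueAtInfinity (r : RatFunc ℝ) : ℝ :=
  r.num.coeff r.denom.natDegree / r.denom.leadingCoeff

/-- The real matrix `R(∞)` of a proper transfer matrix `R`. -/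
noncomputable def evalAtInfinity {m n : Type*} (R : TransferMatrix m n) : Matrix m n ℝ :=
  R.map valueAtInfinity

/-- The matrix `j [R(jω) - R(jω)^*]`. -/
noncomputable def negImagPart {n : Type*} (R : TransferMatrix n n) (ω : ℝ) : Matrix n n ℂ :=
  Complex.I • (evalAt R (Complex.I * ω) - (evalAt R (Complex.I * ω)).conjTranspose)

/-- Stable systems with negative imaginary frequency response. -/
def classC (n : Type*) : Set (TransferMatrix n n) :=
  {R | R ∈ RHInf n n ∧ ∀ ω : ℝ, 0 < ω → (negImagPart R ω).PosSemidef}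

/-- Stable systems with strictly negative imaginary frequency response. -/
def classCs (n : Type*) : Set (TransferMatrix n n) :=
  {R | R ∈ RHInf n n ∧ ∀ ω : ℝ, 0 < ω → (negImagPart R ω).PosDef}

/-- The matrix of the loop equations `e₁ - N e₂ = w₁`, `e₂ - M e₁ = w₂` of the positive feedback
interconnection `[M, N]`; `e₁`, `e₂` are the inputs of `M`, `N`, and `w₁`, `w₂` are the external
signals injected there. -/
noncomputable def loopMatrix {n : Type*} [DecidableEq n] (M N : TransferMatrix n n) :
    TransferMatrix (n ⊕ n) (n ⊕ n) :=
  Matrix.fromBlocks 1 (-N) (-M) 1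

/-- Internal stability of `[M, N]`: the loop equations can be solved, and the closed-loop transfer
matrix from `(w₁, w₂)` to `(e₁, e₂)` is proper and stable. -/
def InternallyStable {n : Type*} [Fintype n] [DecidableEq n] (M N : TransferMatrix n n) : Prop :=
  IsUnit (loopMatrix M N).det ∧ (loopMatrix M N)⁻¹ ∈ RHInf (n ⊕ n) (n ⊕ n)

/-- All (complex) eigenvalues of a square complex matrix are real. -/
def HasOnlyRealEigenvalues {n : Type*} [Fintype n] [DecidableEq n] (A : Matrix n n ℂ) : Prop :=
  ∀ z ∈ spectrum ℂ A, z.im = 0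

/-- The maximum eigenvalue of a square complex matrix that has only real eigenvalues. -/
noncomputable def maxEigenvalue {n : Type*} [Fintype n] [DecidableEq n] (A : Matrix n n ℂ) : ℝ :=
  sSup {x : ℝ | (x : ℂ) ∈ spectrum ℂ A}

end NegImag

/-! ### The ring of proper stable rational functions and its evaluations. -/

namespace NegImag

open Polynomial Filter Topology

/-! Since `M(∞)N(∞) = 0`, internal stability means that `det(1 - M(s)N(s))` has no zero in the
closed right half-plane (`internallyStable_iff`). The rest is positivity: Phragmén–Lindelöf for
`exp(-f)` spreads `Re f ≥ 0` from the imaginary axis to the half-plane. For a negative imaginary `F`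
this makes `(F(0) - F(s))/s` positive real, so `F(∞) ≤ F(0)`. For `N`, the maximum principle
sharpens this to `N(0) > 0` (`posDef_zero`).

Sufficiency (`det_one_sub_mul_ne_zero`): `-N⁻¹` is again negative imaginary, up to a regularization,
so `(M(0) - M(s))/s` and `(N(s)⁻¹ - N(0)⁻¹)/s` both have nonnegative real part. If `M(s)N(s)x = x`,
then on the vector `N(s)x` the terms at `s` cancel, leaving `(M(0) - N(0)⁻¹)/s`, whose real part is
negative there when all eigenvalues of `M(0)N(0)` are below 1. Zeros on the axis are excluded by
strictness of `N`, or at the origin by the DC condition itself.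

Necessity (`eigenvalue_lt_one`): the closed loop `N(1 - MN)⁻¹` is negative imaginary with value
`N(∞) ≥ 0` at infinity, hence is nonnegative at 0. On an eigenvector `x` for `t` this reads `(1 - t)
x^*N(0)x ≥ 0`, and `t = 1` would make `1 - M(0)N(0)` singular. -/

lemma isProperStable_div {p q : ℝ[X]} (hdeg : p.natDegree ≤ q.natDegree)
    (hq : ∀ s : ℂ, 0 ≤ s.re → aeval s q ≠ 0) :
    IsProperStable (algebraMap ℝ[X] (RatFunc ℝ) p / algebraMap ℝ[X] (RatFunc ℝ) q) := by
  have hq0 : q ≠ 0 := by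
    rintro rfl
    exact hq 0 le_rfl (by simp)
  set r := algebraMap ℝ[X] (RatFunc ℝ) p / algebraMap ℝ[X] (RatFunc ℝ) q with hr
  -- Reducing the fraction lowers both degrees equally and can only remove poles.
  have hcross : r.num * q = p * r.denom := (RatFunc.num_mul_eq_mul_denom_iff hq0).2 hr
  refine ⟨?_, fun s hs h => ?_⟩
  · by_cases hp : p = 0
    · simp [hr, hp]
    · have hnum : r.num ≠ 0 := by
        intro h
        rw [h, zero_mul, eq_comm, mul_eq_zero] at hcross
        exact hcross.elim hp r.denom_ne_zero
      have := congrArg natDegree hcross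
      rw [natDegree_mul hnum hq0, natDegree_mul hp r.denom_ne_zero] at this
      omega
  · obtain ⟨c, hc⟩ := RatFunc.denom_div_dvd p q
    exact hq s hs (by rw [hc, map_mul, h, zero_mul])

lemma IsProperStable.eval₂_denom_ne_zero {r : RatFunc ℝ} (hr : IsProperStable r) {s : ℂ}
    (hs : 0 ≤ s.re) : r.denom.eval₂ (algebraMap ℝ ℂ) s ≠ 0 :=
  hr.2 s hs

/-- The ring of proper stable real-rational functions. -/
noncomputable def properStable : Subring (RatFunc ℝ) where
  carrier := {r | IsProperStable r}
  mul_mem' := by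
    intro a b ha hb
    have h : a * b = algebraMap ℝ[X] (RatFunc ℝ) (a.num * b.num) /
        algebraMap ℝ[X] (RatFunc ℝ) (a.denom * b.denom) := by
      conv_lhs => rw [← RatFunc.num_div_denom a, ← RatFunc.num_div_denom b]
      rw [map_mul, map_mul, div_mul_div_comm]
    rw [Set.mem_ofPred_eq, h]
    refine isProperStable_div ?_ fun s hs => ?_
    · rw [natDegree_mul a.denom_ne_zero b.denom_ne_zero]
      exact natDegree_mul_le.trans (add_le_add ha.1 hb.1)
    · rw [map_mul]
      exact mul_ne_zero (ha.2 s hs) (hb.2 s hs)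
  one_mem' := ⟨by simp, by simp⟩
  add_mem' := by
    intro a b ha hb
    have h : a + b = algebraMap ℝ[X] (RatFunc ℝ) (a.num * b.denom + a.denom * b.num) /
        algebraMap ℝ[X] (RatFunc ℝ) (a.denom * b.denom) := by
      conv_lhs => rw [← RatFunc.num_div_denom a, ← RatFunc.num_div_denom b]
      rw [map_mul, map_add, map_mul, map_mul, div_add_div]
      · exact RatFunc.algebraMap_ne_zero a.denom_ne_zero
      · exact RatFunc.algebraMap_ne_zero b.denom_ne_zero
    rw [Set.mem_ofPred_eq, h]
    refine isProperStable_div ?_ fun s hs => ?_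
    · rw [natDegree_mul a.denom_ne_zero b.denom_ne_zero]
      refine natDegree_add_le_of_degree_le ?_ ?_
      · exact natDegree_mul_le.trans (add_le_add_left ha.1 _)
      · exact natDegree_mul_le.trans (add_le_add_right hb.1 _)
    · rw [map_mul]
      exact mul_ne_zero (ha.2 s hs) (hb.2 s hs)
  zero_mem' := ⟨by simp, by simp⟩
  neg_mem' := by
    intro a ha
    have h : -a = algebraMap ℝ[X] (RatFunc ℝ) (-a.num) / algebraMap ℝ[X] (RatFunc ℝ) a.denom := by
      conv_lhs => rw [← RatFunc.num_div_denom a]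
      rw [map_neg, neg_div]
    rw [Set.mem_ofPred_eq, h]
    exact isProperStable_div (by simpa using ha.1) ha.2

/-- Evaluation of proper stable functions at a point of the closed right half plane. -/
noncomputable def evalHom (s : ℂ) (hs : 0 ≤ s.re) : properStable →+* ℂ where
  toFun r := RatFunc.eval (algebraMap ℝ ℂ) s r
  map_one' := by simp
  map_zero' := by simp
  map_add' a b := RatFunc.eval_add _ _ (IsProperStable.eval₂_denom_ne_zero a.2 hs)
    (IsProperStable.eval₂_denom_ne_zero b.2 hs)
  map_mul' a b := RatFunc.eval_mul _ _ (IsProperStable.eval₂_denom_ne_zero a.2 hs)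
    (IsProperStable.eval₂_denom_ne_zero b.2 hs)

/-- The quotient is the reflected polynomial evaluated at `s⁻¹`, and `s⁻¹ → 0`. -/
lemma tendsto_aeval_div_pow (p : ℝ[X]) {k : ℕ} (hp : p.natDegree ≤ k) :
    Tendsto (fun s : ℂ => aeval s p / s ^ k) (Bornology.cobounded ℂ) (𝓝 (p.coeff k : ℂ)) := by
  have h1 : Tendsto (fun s : ℂ => aeval s⁻¹ (reflect k p)) (Bornology.cobounded ℂ)
      (𝓝 (aeval (0 : ℂ) (reflect k p))) :=
    ((Polynomial.continuous_aeval _).tendsto 0).comp tendsto_inv₀_cobounded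
  have h2 : aeval (0 : ℂ) (reflect k p) = (p.coeff k : ℂ) := by
    rw [← coeff_zero_eq_aeval_zero', coeff_reflect, revAt_le (Nat.zero_le k)]
    simp
  rw [h2] at h1
  refine h1.congr' ?_
  filter_upwards [Bornology.eventually_ne_cobounded (0 : ℂ)] with s hs
  let := invertibleOfNonzero hs
  have := eval₂_reflect_mul_pow (algebraMap ℝ ℂ) s k p hp
  rw [invOf_eq_inv] at this
  rw [aeval_def, aeval_def, ← this, mul_div_cancel_right₀ _ (pow_ne_zero _ hs)]

lemma tendsto_aeval_div (p : ℝ[X]) {q : ℝ[X]} (hq : q ≠ 0) (hp : p.natDegree ≤ q.natDegree) :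
    Tendsto (fun s : ℂ => aeval s p / aeval s q) (Bornology.cobounded ℂ)
      (𝓝 ((p.coeff q.natDegree / q.leadingCoeff : ℝ) : ℂ)) := by
  have h := (tendsto_aeval_div_pow p hp).div (tendsto_aeval_div_pow q le_rfl)
    (by simpa using hq)
  rw [Complex.ofReal_div]
  refine h.congr' ?_
  filter_upwards [Bornology.eventually_ne_cobounded (0 : ℂ)] with s hs
  exact div_div_div_cancel_right₀ (pow_ne_zero _ hs) _ _

lemma IsProperStable.tendsto_eval {r : RatFunc ℝ} (hr : IsProperStable r) :
    Tendsto (fun s : ℂ => r.eval (algebraMap ℝ ℂ) s) (Bornology.cobounded ℂ)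
      (𝓝 (valueAtInfinity r : ℂ)) :=
  tendsto_aeval_div r.num r.denom_ne_zero hr.1

/-- Subtracting the value at infinity cancels the top coefficient, so one factor `s` can be
afforded. This supplies the boundedness that Phragmén–Lindelöf needs for `s(F(s) - F(∞))`. -/
lemma IsProperStable.exists_tendsto_mul_sub {r : RatFunc ℝ} (hr : IsProperStable r) :
    ∃ c : ℂ, Tendsto (fun s : ℂ => s * (r.eval (algebraMap ℝ ℂ) s - valueAtInfinity r))
      (Bornology.cobounded ℂ) (𝓝 c) := by
  set c := valueAtInfinity r with hc
  have hlead : r.denom.leadingCoeff ≠ 0 := leadingCoeff_ne_zero.2 r.denom_ne_zero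
  set p : ℝ[X] := X * (r.num - C c * r.denom) with hp
  have hdeg : p.natDegree ≤ r.denom.natDegree := by
    rw [natDegree_le_iff_coeff_eq_zero]
    intro m hm
    obtain ⟨m, rfl⟩ : ∃ l, m = l + 1 := ⟨m - 1, by omega⟩
    rw [hp, coeff_X_mul, coeff_sub, coeff_C_mul]
    rcases (Nat.lt_succ_iff.1 hm).eq_or_lt with h | h
    · rw [← h, coeff_natDegree, hc, valueAtInfinity, div_mul_cancel₀ _ hlead, sub_self]
    · rw [coeff_eq_zero_of_natDegree_lt h, coeff_eq_zero_of_natDegree_lt (hr.1.trans_lt h)]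
      simp
  refine ⟨_, ((tendsto_aeval_div p r.denom_ne_zero hdeg).congr' ?_)⟩
  have hne : ∀ᶠ s : ℂ in Bornology.cobounded ℂ, aeval s r.denom ≠ 0 := by
    have h := (tendsto_aeval_div_pow r.denom le_rfl).eventually_ne
      (b₂ := 0) (by simpa using r.denom_ne_zero)
    filter_upwards [h] with s hs h0
    simp [h0] at hs
  filter_upwards [hne] with s hs
  have : r.eval (algebraMap ℝ ℂ) s = aeval s r.num / aeval s r.denom := rfl
  rw [this, hp]
  simp only [map_mul, map_sub, aeval_X, aeval_C, Complex.coe_algebraMap]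
  field_simp

lemma IsProperStable.differentiableAt_eval {r : RatFunc ℝ} (hr : IsProperStable r) {s : ℂ}
    (hs : 0 ≤ s.re) : DifferentiableAt ℂ (fun z : ℂ => r.eval (algebraMap ℝ ℂ) z) s :=
  (Polynomial.differentiableAt_aeval _).div (Polynomial.differentiableAt_aeval _) (hr.2 s hs)

lemma eval_conj (r : RatFunc ℝ) (s : ℂ) :
    r.eval (algebraMap ℝ ℂ) (starRingEnd ℂ s) = starRingEnd ℂ (r.eval (algebraMap ℝ ℂ) s) := by
  have h (p : ℝ[X]) : aeval (starRingEnd ℂ s) p = starRingEnd ℂ (aeval s p) :=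
    aeval_algHom_apply (Complex.conjAe : ℂ →ₐ[ℝ] ℂ) s p
  change aeval _ r.num / aeval _ r.denom = starRingEnd ℂ (aeval _ r.num / aeval _ r.denom)
  rw [h, h, map_div₀]

end NegImag

/-! ### Internal stability as nonvanishing of a determinant. -/

namespace NegImag

open Polynomial Filter Topology Matrix


section Lift

variable {m n : Type*}

/-- Over the subring, evaluation is a ring homomorphism, hence commutes with products, determinants
and adjugates. -/
lemma exists_map_subtype_eq {A : TransferMatrix m n} (hA : A ∈ RHInf m n) :
    ∃ A' : Matrix m n properStable, A'.map properStable.subtype = A :=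
  ⟨Matrix.of fun i j => ⟨A i j, hA i j⟩, by ext i j; simp⟩

lemma evalAt_map_subtype (A : Matrix m n properStable) {s : ℂ} (hs : 0 ≤ s.re) :
    evalAt (A.map properStable.subtype) s = A.map (evalHom s hs) := rfl

lemma tendsto_evalAt {A : TransferMatrix m n} (hA : A ∈ RHInf m n) :
    Tendsto (evalAt A) (Bornology.cobounded ℂ)
      (𝓝 ((evalAtInfinity A).map (algebraMap ℝ ℂ))) :=
  tendsto_pi_nhds.2 fun i => tendsto_pi_nhds.2 fun j => (hA i j).tendsto_eval

lemma evalAt_mul [Fintype n] {A B : TransferMatrix n n} (hA : A ∈ RHInf n n) (hB : B ∈ RHInf n n) {s : ℂ}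
    (hs : 0 ≤ s.re) : evalAt (A * B) s = evalAt A s * evalAt B s := by
  obtain ⟨A, rfl⟩ := exists_map_subtype_eq hA
  obtain ⟨B, rfl⟩ := exists_map_subtype_eq hB
  rw [← Matrix.map_mul, evalAt_map_subtype _ hs, evalAt_map_subtype _ hs,
    evalAt_map_subtype _ hs, Matrix.map_mul]

lemma evalAt_one [DecidableEq n] (s : ℂ) : evalAt (1 : TransferMatrix n n) s = 1 := by
  rw [evalAt, Matrix.map_one _ (RatFunc.eval_zero _ _) (RatFunc.eval_one _ _)]

lemma evalAt_neg {A : TransferMatrix n n} (hA : A ∈ RHInf n n) {s : ℂ} (hs : 0 ≤ s.re) :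
    evalAt (-A) s = -evalAt A s := by
  ext i j
  exact map_neg (evalHom s hs) ⟨A i j, hA i j⟩

lemma loopMatrix_mem_RHInf [DecidableEq n] {M N : TransferMatrix n n} (hM : M ∈ RHInf n n) (hN : N ∈ RHInf n n) :
    loopMatrix M N ∈ RHInf (n ⊕ n) (n ⊕ n) := by
  have h1 : ∀ i j, IsProperStable ((1 : TransferMatrix n n) i j) := by
    intro i j
    rw [Matrix.one_apply]
    split_ifs
    exacts [properStable.one_mem, properStable.zero_mem]
  rintro (i | i) (j | j)
  exacts [h1 i j, properStable.neg_mem (hN i j), properStable.neg_mem (hM i j), h1 i j]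

end Lift

variable {n : Type*} [Fintype n] [DecidableEq n]

/-- A nonzero value at infinity bounds the degree of the denominator by that of the numerator, so
the inverse is proper; its poles are zeros of `r.num`. -/
lemma IsProperStable.inv {r : RatFunc ℝ}
    (h : ∀ s : ℂ, 0 ≤ s.re → r.eval (algebraMap ℝ ℂ) s ≠ 0) (hinf : valueAtInfinity r ≠ 0) :
    IsProperStable r⁻¹ := by
  rw [← RatFunc.num_div_denom r, inv_div]
  refine isProperStable_div ?_ fun s hs h0 => h s hs ?_
  · refine le_natDegree_of_ne_zero fun h0 => hinf ?_
    rw [valueAtInfinity, h0, zero_div]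
  · rw [RatFunc.eval, ← aeval_def, h0, zero_div]

lemma inv_mem_RHInf {A : TransferMatrix n n} (hA : A ∈ RHInf n n)
    (hdet : IsProperStable (A.det)⁻¹) : A⁻¹ ∈ RHInf n n := by
  obtain ⟨A, rfl⟩ := exists_map_subtype_eq hA
  intro i j
  rw [Matrix.inv_def, Ring.inverse_eq_inv', Matrix.smul_apply, smul_eq_mul]
  refine properStable.mul_mem hdet ?_
  have h : (A.map properStable.subtype).adjugate = A.adjugate.map properStable.subtype :=
    (RingHom.map_adjugate properStable.subtype A).symm
  rw [h]
  exact (A.adjugate i j).2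

lemma evalAt_det {A : TransferMatrix n n} (hA : A ∈ RHInf n n) {s : ℂ} (hs : 0 ≤ s.re) :
    A.det.eval (algebraMap ℝ ℂ) s = (evalAt A s).det := by
  obtain ⟨A, rfl⟩ := exists_map_subtype_eq hA
  have h : (A.map properStable.subtype).det = properStable.subtype A.det :=
    (RingHom.map_det properStable.subtype A).symm
  rw [h, evalAt_map_subtype A hs]
  exact RingHom.map_det (evalHom s hs) A

lemma det_mem_properStable {A : TransferMatrix n n} (hA : A ∈ RHInf n n) :
    IsProperStable A.det := by
  obtain ⟨A, rfl⟩ := exists_map_subtype_eq hA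
  have h : (A.map properStable.subtype).det = properStable.subtype A.det :=
    (RingHom.map_det properStable.subtype A).symm
  rw [h]
  exact A.det.2

lemma det_evalAt_loopMatrix {M N : TransferMatrix n n} (hM : M ∈ RHInf n n) (hN : N ∈ RHInf n n)
    {s : ℂ} (hs : 0 ≤ s.re) :
    (evalAt (loopMatrix M N) s).det = (1 - evalAt M s * evalAt N s).det := by
  have h : evalAt (loopMatrix M N) s = fromBlocks 1 (-evalAt N s) (-evalAt M s) 1 := by
    rw [← evalAt_neg hM hs, ← evalAt_neg hN hs, ← evalAt_one s]
    exact Matrix.fromBlocks_map _ _ _ _ _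
  rw [h, det_fromBlocks_one₁₁, neg_mul_neg]

lemma tendsto_ofReal_atTop_cobounded :
    Tendsto (fun x : ℝ => (x : ℂ)) atTop (Bornology.cobounded ℂ ⊓ 𝓟 {s | 0 < s.re}) := by
  refine tendsto_inf.2 ⟨?_, ?_⟩
  · rw [← tendsto_norm_atTop_iff_cobounded]
    simpa using tendsto_abs_atTop_atTop
  · exact tendsto_principal.2 ((eventually_gt_atTop 0).mono fun x hx => by simpa using hx)

/-- Internal stability amounts to nonsingularity of the return difference in the closed right half
plane, provided that the loop gain vanishes at infinity. -/
lemma internallyStable_iff {M N : TransferMatrix n n} (hM : M ∈ RHInf n n) (hN : N ∈ RHInf n n)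
    (hMN : evalAtInfinity M * evalAtInfinity N = 0) :
    InternallyStable M N ↔
      ∀ s : ℂ, 0 ≤ s.re → (1 - evalAt M s * evalAt N s).det ≠ 0 := by
  have hL := loopMatrix_mem_RHInf hM hN
  constructor
  · rintro ⟨hu, hinv⟩ s hs h0
    have h := congrArg (fun A => (evalAt A s).det) (Matrix.mul_nonsing_inv _ hu)
    simp only [evalAt_mul hL hinv hs, evalAt_one, det_mul, det_evalAt_loopMatrix hM hN hs, h0,
      det_one, zero_mul, zero_ne_one] at h
  · intro h
    have hne : ∀ s : ℂ, 0 ≤ s.re → (loopMatrix M N).det.eval (algebraMap ℝ ℂ) s ≠ 0 := by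
      intro s hs
      rw [evalAt_det hL hs, det_evalAt_loopMatrix hM hN hs]
      exact h s hs
    -- Along the positive real axis the determinant tends both to this value and to `det(1 -
    -- M(∞)N(∞)) = 1`.
    have hinf : valueAtInfinity (loopMatrix M N).det ≠ 0 := by
      have h1 := ((det_mem_properStable hL).tendsto_eval.mono_left inf_le_left).comp
        tendsto_ofReal_atTop_cobounded
      have h2 : Tendsto (fun s => (1 - evalAt M s * evalAt N s).det) (Bornology.cobounded ℂ)
          (𝓝 1) := by
        have h3 := (tendsto_evalAt hM).mul (tendsto_evalAt hN)
        rw [← Matrix.map_mul, hMN] at h3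
        have h4 := (continuous_id.matrix_det.tendsto _).comp
          ((tendsto_const_nhds (x := (1 : Matrix n n ℂ))).sub h3)
        simpa [Function.comp_def] using h4
      have h3 := (h2.mono_left inf_le_left).comp tendsto_ofReal_atTop_cobounded
      have h4 := tendsto_nhds_unique (h1.congr' ?_) h3
      · intro h0
        simp [h0] at h4
      · filter_upwards [eventually_ge_atTop 0] with x hx
        have hx' : 0 ≤ (x : ℂ).re := by simpa using hx
        simp only [Function.comp_apply]
        rw [evalAt_det hL hx', det_evalAt_loopMatrix hM hN hx']
    refine ⟨isUnit_iff_ne_zero.2 fun h0 => hne 0 le_rfl (by rw [h0, RatFunc.eval_zero]), ?_⟩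
    exact inv_mem_RHInf hL (IsProperStable.inv hne hinf)

end NegImag

/-! ### Positivity on the half-plane from positivity on the axis. -/

namespace NegImag

open Filter Topology Matrix

/-- The filter of points of the open right half plane that tend to infinity. -/
noncomputable def rightInfty : Filter ℂ := Bornology.cobounded ℂ ⊓ 𝓟 {s | 0 < s.re}

lemma diffContOnCl_rightHalfPlane {f : ℂ → ℂ} (hf : ∀ s : ℂ, 0 ≤ s.re → ContinuousAt f s)
    (hd : ∀ s : ℂ, 0 < s.re → DifferentiableAt ℂ f s) : DiffContOnCl ℂ f {s | 0 < s.re} := by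
  refine ⟨fun s hs => (hd s hs).differentiableWithinAt, fun s hs => ?_⟩
  rw [Complex.closure_setOfPred_lt_re] at hs
  exact (hf s hs).continuousWithinAt

lemma norm_exp_neg (z : ℂ) : ‖Complex.exp (-z)‖ = Real.exp (-z.re) := by
  rw [Complex.norm_exp, Complex.neg_re]

/-- A function that is continuous on the closed and holomorphic on the open right half plane,
bounded at infinity, with nonnegative real part on the imaginary axis punctured at the origin has
nonnegative real part. -/
lemma re_nonneg_of_re_nonneg_on_imaginary_axis {f : ℂ → ℂ}
    (hf : ∀ s : ℂ, 0 ≤ s.re → ContinuousAt f s)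
    (hd : ∀ s : ℂ, 0 < s.re → DifferentiableAt ℂ f s)
    (hb : f =O[rightInfty] (fun _ => (1 : ℝ)))
    (hre : ∀ ω : ℝ, ω ≠ 0 → 0 ≤ (f (Complex.I * ω)).re) {s : ℂ} (hs : 0 ≤ s.re) :
    0 ≤ (f s).re := by
  -- Continuity fills in the puncture at the origin.
  have him : ∀ ω : ℝ, 0 ≤ (f (Complex.I * ω)).re := by
    intro ω
    have hc : Continuous fun x : ℝ => (f (Complex.I * x)).re := by
      refine Complex.continuous_re.comp (continuous_iff_continuousAt.2 fun x => ?_)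
      exact ContinuousAt.comp (f := fun x : ℝ => Complex.I * (x : ℂ)) (hf _ (by simp)) (by fun_prop)
    have hcl : IsClosed {x : ℝ | 0 ≤ (f (Complex.I * x)).re} := isClosed_le continuous_const hc
    have hdense : Dense ({0}ᶜ : Set ℝ) := dense_compl_singleton 0
    exact hcl.closure_subset_iff.2 (fun x hx => hre x hx) (hdense ω)
  obtain ⟨C, hC⟩ := hb.bound
  have hC' : ∀ᶠ s in rightInfty, ‖Complex.exp (-f s)‖ ≤ Real.exp C := by
    filter_upwards [hC] with s hs
    rw [norm_exp_neg, Real.exp_le_exp]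
    have := (abs_le.1 (Complex.abs_re_le_norm (f s))).1
    simp only [norm_one, mul_one] at hs
    linarith
  -- Phragmén–Lindelöf for `exp(-f)`, of modulus `exp(-Re f)`. The growth condition with `B = 0` is
  -- just boundedness at infinity.
  have hle : ‖Complex.exp (-f s)‖ ≤ 1 := by
    refine PhragmenLindelof.right_half_plane_of_bounded_on_real (f := fun z => Complex.exp (-f z))
      (diffContOnCl_rightHalfPlane (fun s hs => (hf s hs).neg.cexp)
        (fun s hs => (hd s hs).neg.cexp)) ⟨1, by norm_num, 0, ?_⟩ ?_ ?_ hs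
    · refine Asymptotics.IsBigO.of_bound (Real.exp C) ?_
      filter_upwards [hC'] with s hs
      simpa using hs
    · exact ⟨Real.exp C, eventually_map.2 (tendsto_ofReal_atTop_cobounded.eventually hC')⟩
    · intro x
      rw [norm_exp_neg, Real.exp_le_one_iff, mul_comm]
      linarith [him x]
  rw [norm_exp_neg, Real.exp_le_one_iff] at hle
  linarith

/-- Passing to the difference quotient at the origin. -/
lemma re_slope_nonneg {g : ℂ → ℂ} (hd : ∀ s : ℂ, 0 ≤ s.re → DifferentiableAt ℂ g s)
    (hb : g =O[rightInfty] (fun _ => (1 : ℝ)))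
    (him : ∀ ω : ℝ, 0 ≤ ω * ((g (Complex.I * ω)).im - (g 0).im)) {s : ℂ} (hs : 0 < s.re) :
    0 ≤ ((g s - g 0) / s).re := by
  have hval : ∀ z : ℂ, z ≠ 0 → dslope g 0 z = (g z - g 0) / z := by
    intro z hz
    rw [dslope_of_ne _ hz, slope_def_field, sub_zero]
  have hs0 : s ≠ 0 := by
    rintro rfl
    simp at hs
  rw [← hval s hs0]
  -- `dslope` extends the quotient continuously across 0, which lies on the boundary, where
  -- continuity suffices.
  refine re_nonneg_of_re_nonneg_on_imaginary_axis (f := dslope g 0) ?_ ?_ ?_ ?_ hs.le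
  · intro z hz
    rcases eq_or_ne z 0 with rfl | h
    · exact continuousAt_dslope_same.2 (hd 0 hz)
    · exact ((differentiableAt_dslope_of_ne h).2 (hd z hz)).continuousAt
  · intro z hz
    have h : z ≠ 0 := by
      rintro rfl
      simp at hz
    exact (differentiableAt_dslope_of_ne h).2 (hd z hz.le)
  · have h1 : (fun z => (g z - g 0) * z⁻¹) =O[rightInfty] (fun _ => (1 : ℝ) * 1) := by
      refine (hb.sub (Asymptotics.isBigO_const_const _ one_ne_zero _)).mul ?_
      exact (tendsto_inv₀_cobounded.mono_left inf_le_left).isBigO_one ℝ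
    simp only [mul_one] at h1
    refine h1.congr' ?_ EventuallyEq.rfl
    filter_upwards [(Bornology.eventually_ne_cobounded (0 : ℂ)).filter_mono
      (inf_le_left : rightInfty ≤ _)] with z hz
    rw [hval z hz, div_eq_mul_inv]
  · intro ω hω
    have hI : Complex.I * (ω : ℂ) ≠ 0 := mul_ne_zero Complex.I_ne_zero (by exact_mod_cast hω)
    have h2 : (dslope g 0 (Complex.I * ω)).re
        = ω * ((g (Complex.I * ω)).im - (g 0).im) / ω ^ 2 := by
      rw [hval _ hI, Complex.div_re]
      simp [Complex.normSq_apply]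
      field_simp
    rw [h2]
    exact div_nonneg (him ω) (sq_nonneg ω)

end NegImag

/-! ### Quadratic forms and holomorphic matrix functions. -/

namespace NegImag

open Filter Topology Matrix

section QuadForm

variable {n : Type*} [Fintype n]

/-- The quadratic form `v^* A v`. -/
def quadForm (A : Matrix n n ℂ) (v : n → ℂ) : ℂ := star v ⬝ᵥ (A *ᵥ v)

lemma quadForm_sub (A B : Matrix n n ℂ) (v : n → ℂ) :
    quadForm (A - B) v = quadForm A v - quadForm B v := by
  simp only [quadForm, sub_mulVec, dotProduct_sub]

lemma quadForm_add (A B : Matrix n n ℂ) (v : n → ℂ) :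
    quadForm (A + B) v = quadForm A v + quadForm B v := by
  simp only [quadForm, add_mulVec, dotProduct_add]

lemma quadForm_neg (A : Matrix n n ℂ) (v : n → ℂ) : quadForm (-A) v = -quadForm A v := by
  simp only [quadForm, neg_mulVec, dotProduct_neg]

lemma quadForm_smul (c : ℂ) (A : Matrix n n ℂ) (v : n → ℂ) :
    quadForm (c • A) v = c * quadForm A v := by
  simp only [quadForm, smul_mulVec, dotProduct_smul, smul_eq_mul]

lemma star_dotProduct_comm (v w : n → ℂ) : star w ⬝ᵥ v = star (star v ⬝ᵥ w) := by
  rw [star_dotProduct]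

lemma quadForm_conjTranspose (A : Matrix n n ℂ) (v : n → ℂ) :
    quadForm A.conjTranspose v = star (quadForm A v) := by
  rw [quadForm, quadForm, ← star_dotProduct_comm, star_mulVec, ← dotProduct_mulVec]

lemma continuous_quadForm (v : n → ℂ) : Continuous fun A : Matrix n n ℂ => quadForm A v := by
  unfold quadForm
  fun_prop

lemma isHermitian_iff_quadForm_im {A : Matrix n n ℂ} :
    A.IsHermitian ↔ ∀ v, (quadForm A v).im = 0 := by
  classical
  constructor
  · intro h v
    have h1 := quadForm_conjTranspose A v
    rw [h.eq] at h1
    exact Complex.conj_eq_iff_im.1 h1.symm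
  · intro h
    rw [← isSymmetric_toEuclideanLin_iff, LinearMap.isSymmetric_iff_inner_map_self_real]
    intro v
    rw [Complex.conj_eq_iff_im]
    have h1 : inner ℂ (toEuclideanLin A v) v = star (quadForm A v.ofLp) := by
      rw [quadForm, ← star_dotProduct_comm, EuclideanSpace.inner_eq_star_dotProduct,
        dotProduct_comm]
      rfl
    rw [h1, Complex.star_def, Complex.conj_im, h, neg_zero]

/-- Substituting `v = A u` in the quadratic form of the inverse. -/
lemma quadForm_inv_mulVec [DecidableEq n] {A : Matrix n n ℂ} (hA : A.det ≠ 0) (u : n → ℂ) :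
    quadForm A⁻¹ (A *ᵥ u) = star (quadForm A u) := by
  rw [quadForm, mulVec_mulVec, nonsing_inv_mul _ (isUnit_iff_ne_zero.2 hA), one_mulVec,
    star_dotProduct_comm, quadForm]

lemma exists_mulVec_eq [DecidableEq n] {A : Matrix n n ℂ} (hA : A.det ≠ 0) (v : n → ℂ) :
    ∃ u, A *ᵥ u = v :=
  ⟨A⁻¹ *ᵥ v, by rw [mulVec_mulVec, mul_nonsing_inv _ (isUnit_iff_ne_zero.2 hA), one_mulVec]⟩

end QuadForm

section Differentiability

variable {n : Type*}

/-- Entrywise complex differentiability of a matrix-valued function. -/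
def EntrywiseDifferentiableAt (F : ℂ → Matrix n n ℂ) (s : ℂ) : Prop :=
  ∀ i j, DifferentiableAt ℂ (fun z => F z i j) s

variable {F G : ℂ → Matrix n n ℂ} {s : ℂ}

lemma EntrywiseDifferentiableAt.quadForm [Fintype n] (hF : EntrywiseDifferentiableAt F s) (v : n → ℂ) :
    DifferentiableAt ℂ (fun z => quadForm (F z) v) s := by
  unfold NegImag.quadForm dotProduct mulVec dotProduct
  refine DifferentiableAt.fun_sum fun i _ => DifferentiableAt.const_mul ?_ _
  exact DifferentiableAt.fun_sum fun j _ => (hF i j).mul_const _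

lemma EntrywiseDifferentiableAt.neg (hF : EntrywiseDifferentiableAt F s) :
    EntrywiseDifferentiableAt (fun z => -F z) s := fun i j => (hF i j).neg

lemma EntrywiseDifferentiableAt.add_const (hF : EntrywiseDifferentiableAt F s)
    (A : Matrix n n ℂ) : EntrywiseDifferentiableAt (fun z => F z + A) s :=
  fun i j => (hF i j).add_const _

lemma EntrywiseDifferentiableAt.const_sub (hF : EntrywiseDifferentiableAt F s)
    (A : Matrix n n ℂ) : EntrywiseDifferentiableAt (fun z => A - F z) s :=
  fun i j => (hF i j).const_sub _

lemma EntrywiseDifferentiableAt.mul [Fintype n] (hF : EntrywiseDifferentiableAt F s)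
    (hG : EntrywiseDifferentiableAt G s) : EntrywiseDifferentiableAt (fun z => F z * G z) s := by
  intro i j
  simp only [Matrix.mul_apply]
  exact DifferentiableAt.fun_sum fun k _ => (hF i k).mul (hG k j)

variable [Fintype n] [DecidableEq n]

lemma EntrywiseDifferentiableAt.det (hF : EntrywiseDifferentiableAt F s) :
    DifferentiableAt ℂ (fun z => (F z).det) s := by
  simp only [Matrix.det_apply]
  exact DifferentiableAt.fun_sum fun σ _ =>
    (DifferentiableAt.fun_finsetProd fun i _ => hF (σ i) i).const_smul _

lemma EntrywiseDifferentiableAt.inv (hF : EntrywiseDifferentiableAt F s) (hdet : (F s).det ≠ 0) :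
    EntrywiseDifferentiableAt (fun z => (F z)⁻¹) s := by
  intro i j
  simp only [Matrix.inv_def, Ring.inverse_eq_inv', Matrix.smul_apply, smul_eq_mul,
    adjugate_apply]
  refine (hF.det.fun_inv hdet).mul (EntrywiseDifferentiableAt.det fun k l => ?_)
  simp only [updateRow_apply]
  split_ifs
  exacts [differentiableAt_const _, hF k l]

lemma tendsto_matrix_inv {α : Type*} {l : Filter α} {F : α → Matrix n n ℂ} {A : Matrix n n ℂ}
    (hF : Tendsto F l (𝓝 A)) (hA : A.det ≠ 0) : Tendsto (fun x => (F x)⁻¹) l (𝓝 A⁻¹) := by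
  simp only [Matrix.inv_def, Ring.inverse_eq_inv']
  exact (((continuous_id.matrix_det.tendsto A).comp hF).inv₀ hA).smul
    ((continuous_id.matrix_adjugate.tendsto A).comp hF)

end Differentiability

/-! ### Negative imaginary matrix functions. -/

variable {n : Type*} [Fintype n]

/-- Matrix functions that are holomorphic on the closed right half plane, have the limit `A` at
infinity, and have a negative imaginary frequency response. -/
structure IsNegImagFun (F : ℂ → Matrix n n ℂ) (A : Matrix n n ℂ) : Prop where
  differentiableAt : ∀ s : ℂ, 0 ≤ s.re → EntrywiseDifferentiableAt F s
  tendsto : Tendsto F rightInfty (𝓝 A)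
  mul_im_nonpos : ∀ (ω : ℝ) v, ω * (quadForm (F (Complex.I * ω)) v).im ≤ 0

namespace IsNegImagFun

variable {F G : ℂ → Matrix n n ℂ} {A B : Matrix n n ℂ}

lemma tendsto_quadForm (hF : IsNegImagFun F A) (v : n → ℂ) :
    Tendsto (fun s => quadForm (F s) v) rightInfty (𝓝 (quadForm A v)) :=
  ((continuous_quadForm v).tendsto A).comp hF.tendsto

/-- The imaginary part of the form has opposite signs for `ω > 0` and `ω < 0`, so by continuity it
vanishes at 0. -/
lemma isHermitian_zero (hF : IsNegImagFun F A) : (F 0).IsHermitian := by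
  refine isHermitian_iff_quadForm_im.2 fun v => ?_
  have hc : Tendsto (fun ω : ℝ => (quadForm (F (Complex.I * ω)) v).im) (𝓝 0)
      (𝓝 (quadForm (F 0) v).im) := by
    have h1 : ContinuousAt (fun z => quadForm (F z) v) (Complex.I * (0 : ℝ)) :=
      ((hF.differentiableAt _ (by simp)).quadForm v).continuousAt
    have h2 : ContinuousAt (fun ω : ℝ => quadForm (F (Complex.I * ω)) v) 0 :=
      ContinuousAt.comp (f := fun x : ℝ => Complex.I * (x : ℂ)) h1 (by fun_prop)
    simpa [Function.comp_def] using (Complex.continuous_im.tendsto _).comp h2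
  apply le_antisymm
  · refine le_of_tendsto (hc.mono_left (nhdsWithin_le_nhds (s := Set.Ioi 0))) ?_
    filter_upwards [self_mem_nhdsWithin] with ω hω
    exact nonpos_of_mul_nonpos_right (hF.mul_im_nonpos ω v) hω
  · refine ge_of_tendsto (hc.mono_left (nhdsWithin_le_nhds (s := Set.Iio 0))) ?_
    filter_upwards [self_mem_nhdsWithin] with ω hω
    have := hF.mul_im_nonpos ω v
    by_contra! h
    nlinarith [mul_pos_of_neg_of_neg hω h]

lemma re_slope_nonneg (hF : IsNegImagFun F A) (v : n → ℂ) {s : ℂ} (hs : 0 < s.re) :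
    0 ≤ ((quadForm (F 0) v - quadForm (F s) v) / s).re := by
  have h := NegImag.re_slope_nonneg (g := fun z => -quadForm (F z) v)
    (fun z hz => ((hF.differentiableAt z hz).quadForm v).neg)
    ((hF.tendsto_quadForm v).neg.isBigO_one ℝ) ?_ hs
  · convert h using 3
    ring
  · intro ω
    have := hF.mul_im_nonpos ω v
    simp only [Complex.neg_im, isHermitian_iff_quadForm_im.1 hF.isHermitian_zero v]
    linarith

lemma quadForm_re_le_zero (hF : IsNegImagFun F A) (v : n → ℂ) {σ : ℝ} (hσ : 0 < σ) :
    (quadForm (F σ) v).re ≤ (quadForm (F 0) v).re := by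
  have h := hF.re_slope_nonneg v (s := σ) (by simpa using hσ)
  rw [Complex.div_ofReal_re, Complex.sub_re] at h
  have h' := mul_nonneg h hσ.le
  rw [div_mul_cancel₀ _ hσ.ne'] at h'
  linarith

lemma quadForm_infty_le_zero (hF : IsNegImagFun F A) (v : n → ℂ) :
    (quadForm A v).re ≤ (quadForm (F 0) v).re := by
  have h := ((Complex.continuous_re.tendsto _).comp (hF.tendsto_quadForm v)).comp
    tendsto_ofReal_atTop_cobounded
  refine le_of_tendsto h ?_
  filter_upwards [eventually_gt_atTop 0] with σ hσ
  exact hF.quadForm_re_le_zero v hσ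

/-- If `s (F(s) - F(∞))` is bounded then it is positive real. -/
lemma re_mul_sub_nonneg (hF : IsNegImagFun F A) (hA : A.IsHermitian) {C : Matrix n n ℂ}
    (hC : Tendsto (fun s => s • (F s - A)) rightInfty (𝓝 C)) (v : n → ℂ) {s : ℂ}
    (hs : 0 ≤ s.re) : 0 ≤ (s * (quadForm (F s) v - quadForm A v)).re := by
  have hd : ∀ z : ℂ, 0 ≤ z.re →
      DifferentiableAt ℂ (fun z => z * (quadForm (F z) v - quadForm A v)) z := fun z hz =>
    differentiableAt_id.mul (((hF.differentiableAt z hz).quadForm v).sub_const _)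
  refine re_nonneg_of_re_nonneg_on_imaginary_axis
    (f := fun z => z * (quadForm (F z) v - quadForm A v)) (fun z hz => (hd z hz).continuousAt)
    (fun z hz => hd z hz.le) ?_ ?_ hs
  · have h := ((continuous_quadForm v).tendsto C).comp hC
    simp only [Function.comp_def, quadForm_smul, quadForm_sub] at h
    exact h.isBigO_one ℝ
  · intro ω _
    have := hF.mul_im_nonpos ω v
    simp [isHermitian_iff_quadForm_im.1 hA v]
    linarith

/-- If the static gain and the gain at infinity coincide in some direction, then the frequency
response is real in that direction. -/
lemma im_eq_zero_of_quadForm_zero_eq (hF : IsNegImagFun F A) (hA : A.IsHermitian)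
    {C : Matrix n n ℂ} (hC : Tendsto (fun s => s • (F s - A)) rightInfty (𝓝 C)) {v : n → ℂ}
    (hv : (quadForm (F 0) v).re ≤ (quadForm A v).re) : (quadForm (F Complex.I) v).im = 0 := by
  set h : ℂ → ℂ := fun z => z * (quadForm (F z) v - quadForm A v) with hh
  have hd : ∀ z : ℂ, 0 ≤ z.re → DifferentiableAt ℂ h z := fun z hz =>
    differentiableAt_id.mul (((hF.differentiableAt z hz).quadForm v).sub_const _)
  have hnn : ∀ z : ℂ, 0 ≤ z.re → 0 ≤ (h z).re := fun z hz => hF.re_mul_sub_nonneg hA hC v hz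
  -- `h 1` is the form of `F(1) - A`, and `F(1) ≤ F(0)`, which in this direction is at most `A`.
  have h1 : (h 1).re = 0 := by
    refine le_antisymm ?_ (hnn 1 (by simp))
    have := hF.quadForm_re_le_zero v one_pos
    rw [Complex.ofReal_one] at this
    simp only [hh, one_mul, Complex.sub_re]
    linarith
  -- `exp(-h)` attains its maximum modulus at the interior point 1, so the modulus is constant up to
  -- the boundary; at `i` this gives `Re h(i) = 0`.
  have hmax : IsMaxOn (norm ∘ fun z => Complex.exp (-h z)) {s : ℂ | 0 < s.re} 1 := by
    intro z hz
    simp only [Set.mem_ofPred_eq, Function.comp_apply, norm_exp_neg, Real.exp_le_exp, h1]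
    linarith [hnn z (le_of_lt hz)]
  have hpre : IsPreconnected {s : ℂ | 0 < s.re} :=
    (convex_halfSpace_re_gt 0).isPreconnected
  have hopen : IsOpen {s : ℂ | 0 < s.re} := isOpen_lt continuous_const Complex.continuous_re
  have heq := Complex.norm_eqOn_closure_of_isPreconnected_of_isMaxOn hpre hopen
    (diffContOnCl_rightHalfPlane (fun z hz => (hd z hz).neg.cexp.continuousAt)
      fun z hz => (hd z hz.le).neg.cexp) (by simp) hmax
  rw [Complex.closure_setOfPred_lt_re] at heq
  have hI : ‖Complex.exp (-h Complex.I)‖ = ‖Complex.exp (-h 1)‖ := heq (by simp)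
  rw [norm_exp_neg, norm_exp_neg, Real.exp_eq_exp, h1] at hI
  simpa [hh, isHermitian_iff_quadForm_im.1 hA v] using hI

variable [DecidableEq n]

/-- With `v = F u`, the form of `F⁻¹` at `v` is the conjugate of that of `F` at `u`; the minus sign
undoes the conjugation. -/
lemma neg_inv (hF : IsNegImagFun F A) (hdet : ∀ s : ℂ, 0 ≤ s.re → (F s).det ≠ 0)
    (hA : A.det ≠ 0) : IsNegImagFun (fun s => -(F s)⁻¹) (-A⁻¹) where
  differentiableAt s hs := ((hF.differentiableAt s hs).inv (hdet s hs)).neg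
  tendsto := (tendsto_matrix_inv hF.tendsto hA).neg
  mul_im_nonpos ω v := by
    have hd := hdet (Complex.I * ω) (by simp)
    obtain ⟨u, rfl⟩ := exists_mulVec_eq hd v
    rw [quadForm_neg, quadForm_inv_mulVec hd]
    simpa using hF.mul_im_nonpos ω u

/-- The closed-loop transfer function `N (1 - M N)⁻¹` is negative imaginary. -/
lemma closedLoop (hF : IsNegImagFun F A) (hG : IsNegImagFun G B)
    (hdet : ∀ s : ℂ, 0 ≤ s.re → (1 - F s * G s).det ≠ 0) (hAB : A * B = 0) :
    IsNegImagFun (fun s => G s * (1 - F s * G s)⁻¹) B where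
  differentiableAt s hs := (hG.differentiableAt s hs).mul
    ((((hF.differentiableAt s hs).mul (hG.differentiableAt s hs)).const_sub 1).inv (hdet s hs))
  tendsto := by
    have h := (tendsto_const_nhds (x := (1 : Matrix n n ℂ))).sub (hF.tendsto.mul hG.tendsto)
    rw [hAB, sub_zero] at h
    simpa using hG.tendsto.mul (tendsto_matrix_inv h (by simp))
  mul_im_nonpos ω v := by
    have hd := hdet (Complex.I * ω) (by simp)
    obtain ⟨u, rfl⟩ := exists_mulVec_eq hd v
    set M := F (Complex.I * ω)
    set N := G (Complex.I * ω)
    -- Substituting `v = (1 - MN)u` splits the form into one of `N` and a conjugated one of `M`.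
    have h1 : quadForm (N * (1 - M * N)⁻¹) ((1 - M * N) *ᵥ u)
        = quadForm N u - star (quadForm M (N *ᵥ u)) := by
      rw [quadForm, mulVec_mulVec, Matrix.mul_assoc, nonsing_inv_mul _ (isUnit_iff_ne_zero.2 hd),
        Matrix.mul_one, sub_mulVec, one_mulVec, star_sub, sub_dotProduct, ← mulVec_mulVec,
        star_dotProduct_comm _ (M *ᵥ _)]
      rfl
    rw [h1]
    have h2 := hF.mul_im_nonpos ω (N *ᵥ u)
    have h3 := hG.mul_im_nonpos ω u
    simp only [Complex.sub_im, Complex.star_def, Complex.conj_im]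
    linarith

end IsNegImagFun

end NegImag

/-! ### From transfer matrices to negative imaginary functions. -/

namespace NegImag

open Filter Topology Matrix

variable {n : Type*}

lemma classCs_subset_classC : classCs n ⊆ classC n :=
  fun _ hR => ⟨hR.1, fun ω hω => (hR.2 ω hω).posSemidef⟩

lemma exists_tendsto_smul_sub {R : TransferMatrix n n} (hR : R ∈ RHInf n n) :
    ∃ C, Tendsto (fun s => s • (evalAt R s - (evalAtInfinity R).map (algebraMap ℝ ℂ)))
      rightInfty (𝓝 C) := by
  choose C hC using fun i j => (hR i j).exists_tendsto_mul_sub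
  exact ⟨Matrix.of C, tendsto_pi_nhds.2 fun i => tendsto_pi_nhds.2 fun j =>
    (hC i j).mono_left inf_le_left⟩

variable [Fintype n]

lemma exists_real_eq_I_mul {s : ℂ} (hs : s.re = 0) : ∃ ω : ℝ, s = Complex.I * ω :=
  ⟨s.im, by apply Complex.ext <;> simp [hs]⟩

lemma quadForm_re_nonneg {A : Matrix n n ℂ} (hA : A.PosSemidef) (v : n → ℂ) :
    0 ≤ (quadForm A v).re :=
  (Complex.nonneg_iff.1 (hA.dotProduct_mulVec_nonneg v)).1

lemma quadForm_re_pos {A : Matrix n n ℂ} (hA : A.PosDef) {v : n → ℂ} (hv : v ≠ 0) :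
    0 < (quadForm A v).re :=
  (Complex.pos_iff.1 (hA.dotProduct_mulVec_pos hv)).1

lemma posDef_of_quadForm_re_pos {A : Matrix n n ℂ} (hA : A.IsHermitian)
    (h : ∀ v ≠ 0, 0 < (quadForm A v).re) : A.PosDef :=
  .of_dotProduct_mulVec_pos hA fun v hv =>
    Complex.pos_iff.2 ⟨h v hv, (isHermitian_iff_quadForm_im.1 hA v).symm⟩

lemma quadForm_negImagPart (R : TransferMatrix n n) (ω : ℝ) (v : n → ℂ) :
    (quadForm (negImagPart R ω) v).re = -2 * (quadForm (evalAt R (Complex.I * ω)) v).im := by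
  rw [negImagPart, quadForm_smul, quadForm_sub, quadForm_conjTranspose]
  simp
  ring

/-- Real coefficients give `R(-iω)` as the entrywise conjugate of `R(iω)`. This carries the sign
conditions from `ω > 0` to `ω < 0`. -/
lemma im_quadForm_evalAt_neg (R : TransferMatrix n n) (ω : ℝ) (v : n → ℂ) :
    (quadForm (evalAt R (Complex.I * (-ω : ℝ))) v).im
      = -(quadForm (evalAt R (Complex.I * ω)) (star v)).im := by
  have h1 : Complex.I * ((-ω : ℝ) : ℂ) = starRingEnd ℂ (Complex.I * ω) := by simp
  have h2 : quadForm (evalAt R (Complex.I * (-ω : ℝ))) v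
      = starRingEnd ℂ (quadForm (evalAt R (Complex.I * ω)) (star v)) := by
    rw [h1]
    simp only [quadForm, dotProduct, mulVec, evalAt, Matrix.map_apply, eval_conj]
    simp only [map_sum, map_mul, Pi.star_apply, Complex.star_def, starRingEnd_self_apply]
  rw [h2, Complex.conj_im]

lemma isNegImagFun_evalAt {R : TransferMatrix n n} (hR : R ∈ classC n) :
    IsNegImagFun (evalAt R) ((evalAtInfinity R).map (algebraMap ℝ ℂ)) where
  differentiableAt s hs i j := (hR.1 i j).differentiableAt_eval hs
  tendsto := (tendsto_evalAt hR.1).mono_left inf_le_left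
  mul_im_nonpos := by
    have hpos : ∀ ω : ℝ, 0 < ω → ∀ v, (quadForm (evalAt R (Complex.I * ω)) v).im ≤ 0 := by
      intro ω hω v
      have h := quadForm_re_nonneg (hR.2 ω hω) v
      rw [quadForm_negImagPart] at h
      linarith
    intro ω v
    rcases lt_trichotomy ω 0 with h | rfl | h
    · have h1 := im_quadForm_evalAt_neg R (-ω) v
      rw [neg_neg] at h1
      rw [h1]
      nlinarith [hpos (-ω) (by linarith) (star v)]
    · simp
    · exact mul_nonpos_of_nonneg_of_nonpos h.le (hpos ω h v)

lemma mul_im_neg_of_mem_classCs {R : TransferMatrix n n} (hR : R ∈ classCs n) {ω : ℝ}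
    (hω : ω ≠ 0) {v : n → ℂ} (hv : v ≠ 0) :
    ω * (quadForm (evalAt R (Complex.I * ω)) v).im < 0 := by
  have hpos : ∀ ω : ℝ, 0 < ω → ∀ v ≠ 0, (quadForm (evalAt R (Complex.I * ω)) v).im < 0 := by
    intro ω hω v hv
    have h := quadForm_re_pos (hR.2 ω hω) hv
    rw [quadForm_negImagPart] at h
    linarith
  rcases lt_or_gt_of_ne hω with h | h
  · have h1 := im_quadForm_evalAt_neg R (-ω) v
    rw [neg_neg] at h1
    rw [h1]
    nlinarith [hpos (-ω) (by linarith) (star v) (by simpa using hv)]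
  · exact mul_neg_of_pos_of_neg h (hpos ω h v hv)

open scoped MatrixOrder in
lemma posSemidef_map_algebraMap {A : Matrix n n ℝ} (hA : A.PosSemidef) :
    (A.map (algebraMap ℝ ℂ)).PosSemidef := by
  classical
  obtain ⟨B, rfl⟩ := CStarAlgebra.nonneg_iff_eq_star_mul_self.mp hA.nonneg
  have h : (star B * B).map (algebraMap ℝ ℂ)
      = (B.map (algebraMap ℝ ℂ)).conjTranspose * B.map (algebraMap ℝ ℂ) := by
    rw [Matrix.map_mul]
    congr 1
    ext i j
    simp [star_eq_conjTranspose]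
  rw [h]
  exact posSemidef_conjTranspose_mul_self _

/-! ### The DC gain condition and closed-loop poles. -/

namespace IsNegImagFun

variable {F G : ℂ → Matrix n n ℂ} {A B C : Matrix n n ℂ}

/-- A direction with `v^*F(0)v ≤ 0 ≤ v^*Av` would make `v^*F(i)v` real, against strictness at `ω =
1`. -/
lemma posDef_zero (hF : IsNegImagFun F A)
    (hstrict : ∀ ω : ℝ, ω ≠ 0 → ∀ v ≠ 0, ω * (quadForm (F (Complex.I * ω)) v).im < 0)
    (hA : A.PosSemidef) (hC : Tendsto (fun s => s • (F s - A)) rightInfty (𝓝 C)) :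
    (F 0).PosDef := by
  refine posDef_of_quadForm_re_pos hF.isHermitian_zero fun v hv => ?_
  by_contra! h
  have h1 := hF.im_eq_zero_of_quadForm_zero_eq hA.isHermitian hC
    (h.trans (quadForm_re_nonneg hA v))
  have h2 := hstrict 1 one_ne_zero v hv
  simp [h1] at h2

variable [DecidableEq n]

/-- Regularization: `A` may be singular, and then `F⁻¹` has no limit at infinity to which `neg_inv`
could apply. -/
lemma add_smul_one (hF : IsNegImagFun F A) (ε : ℝ) :
    IsNegImagFun (fun s => F s + (ε : ℂ) • (1 : Matrix n n ℂ)) (A + (ε : ℂ) • 1) where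
  differentiableAt s hs := (hF.differentiableAt s hs).add_const _
  tendsto := hF.tendsto.add_const _
  mul_im_nonpos ω v := by
    have h := isHermitian_iff_quadForm_im.1 (isHermitian_one (n := n) (α := ℂ)) v
    simp only [quadForm_add, quadForm_smul, Complex.add_im, Complex.im_ofReal_mul, h, mul_zero,
      add_zero]
    exact hF.mul_im_nonpos ω v

/-- A kernel vector gives `v^*F(s)v = -ε|v|²`. This contradicts `F(0) > 0` at the origin, strictness
elsewhere on the axis, and positive realness of `s(F(s) - A)` in the open half-plane. -/
lemma det_add_smul_one_ne_zero (hF : IsNegImagFun F A)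
    (hstrict : ∀ ω : ℝ, ω ≠ 0 → ∀ v ≠ 0, ω * (quadForm (F (Complex.I * ω)) v).im < 0)
    (hA : A.PosSemidef) (hC : Tendsto (fun s => s • (F s - A)) rightInfty (𝓝 C))
    {ε : ℝ} (hε : 0 < ε) {s : ℂ} (hs : 0 ≤ s.re) :
    (F s + (ε : ℂ) • (1 : Matrix n n ℂ)).det ≠ 0 := by
  intro hdet
  obtain ⟨v, hv, h0⟩ := exists_mulVec_eq_zero_iff.2 hdet
  have hq : quadForm (F s) v = -(ε * quadForm 1 v) := by
    have h : quadForm (F s + (ε : ℂ) • 1) v = 0 := by rw [quadForm, h0, dotProduct_zero]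
    rw [quadForm_add, quadForm_smul] at h
    exact eq_neg_of_add_eq_zero_left h
  have h1im := isHermitian_iff_quadForm_im.1 (isHermitian_one (n := n) (α := ℂ)) v
  have h1re := quadForm_re_pos (PosDef.one (n := n) (R := ℂ)) hv
  rcases hs.eq_or_lt with h | h
  · obtain ⟨ω, rfl⟩ := exists_real_eq_I_mul h.symm
    rcases eq_or_ne ω 0 with rfl | hω
    · have h2 := quadForm_re_pos (hF.posDef_zero hstrict hA hC) hv
      simp only [Complex.ofReal_zero, mul_zero] at hq
      simp [hq] at h2
      nlinarith
    · have h2 := hstrict ω hω v hv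
      simp [hq, h1im] at h2
  · have h2 := hF.re_mul_sub_nonneg hA.isHermitian hC v hs
    have h3 := quadForm_re_nonneg hA v
    have h4 := isHermitian_iff_quadForm_im.1 hA.isHermitian v
    simp [hq, h1im, h4] at h2
    nlinarith [mul_pos hε h1re]

/-- The inequality `Re ((F(s)⁻¹ - F(0)⁻¹) / s) ≥ 0`, in a form without the inverse of `F(s)`. -/
lemma re_slope_inv_nonneg (hF : IsNegImagFun F A)
    (hstrict : ∀ ω : ℝ, ω ≠ 0 → ∀ v ≠ 0, ω * (quadForm (F (Complex.I * ω)) v).im < 0)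
    (hA : A.PosSemidef) (hC : Tendsto (fun s => s • (F s - A)) rightInfty (𝓝 C))
    {s : ℂ} (hs : 0 < s.re) (x : n → ℂ) :
    0 ≤ ((star (quadForm (F s) x) - quadForm (F 0)⁻¹ (F s *ᵥ x)) / s).re := by
  have hε : Tendsto (fun ε : ℝ => (ε : ℂ) • (1 : Matrix n n ℂ)) (𝓝[>] 0) (𝓝 0) := by
    have h : Continuous fun ε : ℝ => (ε : ℂ) • (1 : Matrix n n ℂ) := by fun_prop
    simpa using (h.tendsto 0).mono_left nhdsWithin_le_nhds
  have h0 : (F 0).det ≠ 0 := by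
    have := (hF.posDef_zero hstrict hA hC).det_pos
    exact this.ne'
  have hs' : Tendsto (fun ε : ℝ => F s + (ε : ℂ) • (1 : Matrix n n ℂ)) (𝓝[>] 0) (𝓝 (F s)) := by
    simpa using hε.const_add (F s)
  have h0' : Tendsto (fun ε : ℝ => (F 0 + (ε : ℂ) • (1 : Matrix n n ℂ))⁻¹) (𝓝[>] 0)
      (𝓝 (F 0)⁻¹) := by
    refine tendsto_matrix_inv ?_ h0
    simpa using hε.const_add (F 0)
  have hcont : Continuous fun p : Matrix n n ℂ × Matrix n n ℂ =>
      ((star (quadForm p.1 x) - quadForm p.2 (p.1 *ᵥ x)) / s).re := by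
    unfold quadForm
    fun_prop
  -- The claim is the limit `ε ↓ 0` of the slope inequality for `-(F + ε)⁻¹` at the vector `(F(s) +
  -- ε)x`.
  refine ge_of_tendsto ((hcont.tendsto (F s, (F 0)⁻¹)).comp (hs'.prodMk_nhds h0')) ?_
  filter_upwards [self_mem_nhdsWithin] with ε hε
  have hdet : ∀ z : ℂ, 0 ≤ z.re → (F z + (ε : ℂ) • (1 : Matrix n n ℂ)).det ≠ 0 :=
    fun z hz => hF.det_add_smul_one_ne_zero hstrict hA hC hε hz
  have hAε : (A + (ε : ℂ) • (1 : Matrix n n ℂ)).det ≠ 0 := by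
    have h : (A + (ε : ℂ) • (1 : Matrix n n ℂ)).PosDef :=
      PosDef.posSemidef_add hA (PosDef.one.smul (Complex.zero_lt_real.2 hε))
    exact h.det_pos.ne'
  have h := ((hF.add_smul_one ε).neg_inv hdet hAε).re_slope_nonneg
    ((F s + (ε : ℂ) • (1 : Matrix n n ℂ)) *ᵥ x) hs
  rw [quadForm_neg, quadForm_neg, quadForm_inv_mulVec (hdet s hs.le)] at h
  rw [neg_sub_neg] at h
  exact h

/-- The feedback interconnection has no closed-loop pole in the closed right half plane if
`F(0) < G(0)⁻¹`. -/
lemma det_one_sub_mul_ne_zero (hF : IsNegImagFun F A) (hG : IsNegImagFun G B)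
    (hstrict : ∀ ω : ℝ, ω ≠ 0 → ∀ v ≠ 0, ω * (quadForm (G (Complex.I * ω)) v).im < 0)
    (hB : B.PosSemidef) (hC : Tendsto (fun s => s • (G s - B)) rightInfty (𝓝 C))
    (hdc : ∀ v ≠ 0, (quadForm (F 0) (G 0 *ᵥ v)).re < (quadForm (G 0) v).re)
    {s : ℂ} (hs : 0 ≤ s.re) : (1 - F s * G s).det ≠ 0 := by
  intro hdet
  obtain ⟨x, hx, h0⟩ := exists_mulVec_eq_zero_iff.2 hdet
  have hxy : F s *ᵥ (G s *ᵥ x) = x := by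
    rw [sub_mulVec, one_mulVec, sub_eq_zero, ← mulVec_mulVec] at h0
    exact h0.symm
  have hFq : quadForm (F s) (G s *ᵥ x) = star (quadForm (G s) x) := by
    rw [quadForm, hxy, star_dotProduct_comm, quadForm]
  rcases hs.eq_or_lt with h | h
  · obtain ⟨ω, rfl⟩ := exists_real_eq_I_mul h.symm
    rcases eq_or_ne ω 0 with rfl | hω
    · simp only [Complex.ofReal_zero, mul_zero] at hFq
      have := hdc x hx
      simp [hFq] at this
    · have h1 := hF.mul_im_nonpos ω (G (Complex.I * ω) *ᵥ x)
      have h2 := hstrict ω hω x hx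
      rw [hFq] at h1
      simp at h1
      linarith
  · have hG0 : (G 0).PosDef := hG.posDef_zero hstrict hB hC
    -- Writing `G(s)x = G(0)u` turns the form of `G(0)⁻¹` into that of `G(0)` at `u`, as in `hdc`.
    obtain ⟨u, hu⟩ := exists_mulVec_eq hG0.det_pos.ne' (G s *ᵥ x)
    have hu0 : u ≠ 0 := by
      rintro rfl
      rw [mulVec_zero] at hu
      rw [← hu, mulVec_zero] at hxy
      exact hx hxy.symm
    have h1 := hF.re_slope_nonneg (G s *ᵥ x) h
    have h2 := hG.re_slope_inv_nonneg hstrict hB hC h x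
    rw [hFq] at h1
    rw [← hu] at h1 h2
    rw [quadForm_inv_mulVec hG0.det_pos.ne'] at h2
    -- The terms at `s` cancel, leaving a negative real number divided by `s`, while `Re(1/s) > 0`.
    have h3 := add_nonneg h1 h2
    rw [← Complex.add_re, ← add_div, sub_add_sub_cancel] at h3
    have h4 : quadForm (F 0) (G 0 *ᵥ u) - star (quadForm (G 0) u)
        = (((quadForm (F 0) (G 0 *ᵥ u)).re - (quadForm (G 0) u).re : ℝ) : ℂ) := by
      apply Complex.ext
      · simp
      · simp [isHermitian_iff_quadForm_im.1 hF.isHermitian_zero,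
          isHermitian_iff_quadForm_im.1 hG.isHermitian_zero]
    rw [h4, div_eq_mul_inv, Complex.re_ofReal_mul, Complex.inv_re] at h3
    have hs0 : s ≠ 0 := by
      rintro rfl
      simp at h
    have h5 : 0 < s.re / Complex.normSq s := div_pos h (Complex.normSq_pos.2 hs0)
    nlinarith [hdc u hu0]

/-- If the feedback interconnection has no closed-loop pole in the closed right half plane then the
real eigenvalues of `F(0) G(0)` are less than one. -/
lemma eigenvalue_lt_one (hF : IsNegImagFun F A) (hG : IsNegImagFun G B) (hB : B.PosSemidef)
    (hG0 : (G 0).PosDef) (hAB : A * B = 0)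
    (hdet : ∀ s : ℂ, 0 ≤ s.re → (1 - F s * G s).det ≠ 0) {t : ℝ} {x : n → ℂ} (hx : x ≠ 0)
    (ht : (F 0 * G 0) *ᵥ x = (t : ℂ) • x) : t < 1 := by
  have hd := hdet 0 le_rfl
  have hv : (1 - F 0 * G 0) *ᵥ x = ((1 - t : ℝ) : ℂ) • x := by
    rw [sub_mulVec, one_mulVec, ht]
    push_cast
    rw [sub_smul, one_smul]
  have ht1 : t ≠ 1 := by
    rintro rfl
    exact hd (exists_mulVec_eq_zero_iff.1 ⟨x, hx, by simpa using hv⟩)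
  -- The closed loop has value `B ≥ 0` at infinity, and its value at 0 is no smaller.
  have h1 := (quadForm_re_nonneg hB _).trans
    ((hF.closedLoop hG hdet hAB).quadForm_infty_le_zero ((1 - F 0 * G 0) *ᵥ x))
  have h2 : quadForm (G 0 * (1 - F 0 * G 0)⁻¹) ((1 - F 0 * G 0) *ᵥ x)
      = ((1 - t : ℝ) : ℂ) * quadForm (G 0) x := by
    rw [quadForm, mulVec_mulVec, Matrix.mul_assoc, nonsing_inv_mul _ (isUnit_iff_ne_zero.2 hd),
      Matrix.mul_one, hv, star_smul, smul_dotProduct, Complex.star_def, Complex.conj_ofReal,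
      smul_eq_mul, quadForm]
  rw [h2, Complex.re_ofReal_mul] at h1
  have h3 := nonneg_of_mul_nonneg_left h1 (quadForm_re_pos hG0 hx)
  exact lt_of_le_of_ne (by linarith) ht1

end IsNegImagFun

/-! ### Eigenvalues of a Hermitian times a positive definite matrix. -/

section Spectrum

variable [DecidableEq n] {P Q : Matrix n n ℂ}

lemma mem_spectrum_iff_exists_mulVec {A : Matrix n n ℂ} {z : ℂ} :
    z ∈ spectrum ℂ A ↔ ∃ x ≠ 0, A *ᵥ x = z • x := by
  rw [spectrum.mem_iff, isUnit_iff_isUnit_det, isUnit_iff_ne_zero, not_not,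
    ← exists_mulVec_eq_zero_iff]
  simp only [sub_mulVec, sub_eq_zero, Algebra.algebraMap_eq_smul_one, smul_mulVec, one_mulVec, eq_comm]

/-- Pairing `PQx = zx` with `Qx` gives `(Qx)^*P(Qx) = z x^*Qx`, where both forms are real and `x^*Qx
> 0`. -/
lemma hasOnlyRealEigenvalues_mul (hP : P.IsHermitian) (hQ : Q.PosDef) :
    HasOnlyRealEigenvalues (P * Q) := by
  intro z hz
  obtain ⟨x, hx, h⟩ := mem_spectrum_iff_exists_mulVec.1 hz
  have h1 : quadForm P (Q *ᵥ x) = z * star (quadForm Q x) := by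
    rw [quadForm, mulVec_mulVec, h, dotProduct_smul, smul_eq_mul, star_dotProduct_comm, quadForm]
  have h2 := congrArg Complex.im h1
  rw [isHermitian_iff_quadForm_im.1 hP] at h2
  have h3 := isHermitian_iff_quadForm_im.1 hQ.isHermitian x
  simp [h3] at h2
  exact h2.resolve_right (quadForm_re_pos hQ hx).ne'

open scoped MatrixOrder in
-- Factor `Q = b^*b` with `b` invertible: `PQ` is similar to the Hermitian `bPb^*`, so `1 - bPb^*`
-- is positive definite. Its form at `bv` is the difference of the two sides.
lemma quadForm_mulVec_lt (hP : P.IsHermitian) (hQ : Q.PosDef)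
    (h : ∀ t : ℝ, (t : ℂ) ∈ spectrum ℂ (P * Q) → t < 1) {v : n → ℂ} (hv : v ≠ 0) :
    (quadForm P (Q *ᵥ v)).re < (quadForm Q v).re := by
  obtain ⟨b, hb, rfl⟩ :=
    CStarAlgebra.isStrictlyPositive_iff_eq_star_mul_self.1 hQ.isStrictlyPositive
  rw [star_eq_conjTranspose] at *
  have hH : (1 - b * P * bᴴ).IsHermitian :=
    isHermitian_one.sub (isHermitian_mul_mul_conjTranspose b hP)
  have hbdet : IsUnit b.det := (isUnit_iff_isUnit_det b).1 hb
  have hpd : (1 - b * P * bᴴ).PosDef := by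
    refine hH.posDef_iff_eigenvalues_pos.2 fun i => ?_
    set e : n → ℂ := (hH.eigenvectorBasis i).ofLp
    have he : (1 - b * P * bᴴ) *ᵥ e = (hH.eigenvalues i : ℂ) • e := hH.mulVec_eigenvectorBasis i
    have he0 : e ≠ 0 := fun h0 =>
      hH.eigenvectorBasis.orthonormal.ne_zero i (by ext j; exact congrFun h0 j)
    have he1 : (b * P * bᴴ) *ᵥ e = ((1 - hH.eigenvalues i : ℝ) : ℂ) • e := by
      rw [sub_mulVec, one_mulVec] at he
      push_cast
      rw [sub_smul, one_smul, ← he, sub_sub_cancel]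
    have hbe : b *ᵥ (b⁻¹ *ᵥ e) = e := by
      rw [mulVec_mulVec, mul_nonsing_inv _ hbdet, one_mulVec]
    have hlt := h (1 - hH.eigenvalues i) (mem_spectrum_iff_exists_mulVec.2 ⟨b⁻¹ *ᵥ e, ?_, ?_⟩)
    · linarith
    · intro h0
      rw [h0, mulVec_zero] at hbe
      exact he0 hbe.symm
    · rw [← mulVec_smul, ← he1, ← mulVec_mulVec, ← mulVec_mulVec _ bᴴ b, hbe, mulVec_mulVec,
        mulVec_mulVec, Matrix.mul_assoc, ← Matrix.mul_assoc b⁻¹, nonsing_inv_mul _ hbdet,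
        Matrix.one_mul]
  have hbv : b *ᵥ v ≠ 0 := fun h0 => hv (by
    simpa [mulVec_mulVec, nonsing_inv_mul _ hbdet] using congrArg (b⁻¹ *ᵥ ·) h0)
  have h1 := quadForm_re_pos hpd hbv
  have h2 : quadForm 1 (b *ᵥ v) = quadForm (bᴴ * b) v := by
    rw [quadForm, quadForm, one_mulVec, star_mulVec, ← dotProduct_mulVec, mulVec_mulVec]
  have h3 : quadForm (b * P * bᴴ) (b *ᵥ v) = quadForm P ((bᴴ * b) *ᵥ v) := by
    rw [quadForm, quadForm, ← mulVec_mulVec _ bᴴ b, star_mulVec bᴴ, conjTranspose_conjTranspose,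
      ← dotProduct_mulVec, mulVec_mulVec, mulVec_mulVec, mulVec_mulVec, mulVec_mulVec]
  rw [quadForm_sub, h2, h3, Complex.sub_re] at h1
  linarith

/-- Finiteness and nonemptiness make the supremum attained; for an empty index type `sSup ∅ = 0`
would break this for `c ≤ 0`. -/
lemma maxEigenvalue_lt_iff [Nonempty n] {A : Matrix n n ℂ} (hA : HasOnlyRealEigenvalues A) (c : ℝ) :
    maxEigenvalue A < c ↔ ∀ t : ℝ, (t : ℂ) ∈ spectrum ℂ A → t < c := by
  have hfin : {x : ℝ | (x : ℂ) ∈ spectrum ℂ A}.Finite :=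
    A.finite_spectrum.preimage Complex.ofReal_injective.injOn
  have hne : {x : ℝ | (x : ℂ) ∈ spectrum ℂ A}.Nonempty := by
    obtain ⟨z, hz⟩ := spectrum.nonempty_of_isAlgClosed_of_finiteDimensional ℂ A
    refine ⟨z.re, ?_⟩
    rw [Set.mem_ofPred_eq]
    convert hz
    exact Complex.ext rfl (hA z hz).symm
  exact hfin.csSup_lt_iff hne

end Spectrum

end NegImag

theorem theorem1 (n : ℕ) (hn : 0 < n)
    (M N : NegImag.TransferMatrix (Fin n) (Fin n))
    (hM : M ∈ NegImag.classC (Fin n)) (hN : N ∈ NegImag.classCs (Fin n))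
    (hMN : NegImag.evalAtInfinity M * NegImag.evalAtInfinity N = 0)
    (hNinf : (NegImag.evalAtInfinity N).PosSemidef) :
    NegImag.HasOnlyRealEigenvalues (NegImag.evalAt M 0 * NegImag.evalAt N 0) ∧
      (NegImag.InternallyStable M N ↔
        NegImag.maxEigenvalue (NegImag.evalAt M 0 * NegImag.evalAt N 0) < 1) := by
  have : Nonempty (Fin n) := ⟨⟨0, hn⟩⟩
  have hF := NegImag.isNegImagFun_evalAt hM
  have hG := NegImag.isNegImagFun_evalAt (NegImag.classCs_subset_classC hN)
  have hstrict : ∀ ω : ℝ, ω ≠ 0 → ∀ v ≠ 0,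
      ω * (NegImag.quadForm (NegImag.evalAt N (Complex.I * ω)) v).im < 0 :=
    fun ω hω v hv => NegImag.mul_im_neg_of_mem_classCs hN hω hv
  have hB := NegImag.posSemidef_map_algebraMap hNinf
  obtain ⟨C, hC⟩ := NegImag.exists_tendsto_smul_sub hN.1
  have hG0 := hG.posDef_zero hstrict hB hC
  have hreal := NegImag.hasOnlyRealEigenvalues_mul hF.isHermitian_zero hG0
  refine ⟨hreal, ?_⟩
  rw [NegImag.internallyStable_iff hM.1 hN.1 hMN, NegImag.maxEigenvalue_lt_iff hreal]
  constructor
  · intro hdet t ht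
    obtain ⟨x, hx, h⟩ := NegImag.mem_spectrum_iff_exists_mulVec.1 ht
    refine hF.eigenvalue_lt_one hG hB hG0 ?_ hdet hx h
    rw [← Matrix.map_mul, hMN]
    simp
  · intro h s hs
    exact hF.det_one_sub_mul_ne_zero hG hstrict hB hC
      (fun v hv => NegImag.quadForm_mulVec_lt hF.isHermitian_zero hG0 h hv) hs
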